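/- Let $X$ be a complex Banach space and let $\mathcal A(X)$ be the Banach algebra of approximable operators on $X$, i.e. the operator-norm closure in $\mathcal B(X)$ of the finite-rank continuous operators. *Definitions.* For a Banach algebra $A$, let $\mathcal B^2(A;\mathbb C)$ be the space of continuous bilinear functionals $\varphi\colon A\times A\to\mathbb C$ with its usual norm, and let $\mathcal B^2_\pi(A;\mathbb C)$ be the subspace of those of the form $(a,b)\mapsto\xi(ab)$ with $\xi\in A^*$. Put $$|\varphi|_{zp}=\sup\{|\varphi(a,b)|:\|a\|=\|b\|=1,\ ab=0\},$$ $$|\varphi|_{b}=\sup\{|\varphi(ab,c)-\varphi(a,bc)|:\|a\|=\|b\|=\|c\|=1\},$$ with $\sup\varnothing=0$. The algebra $A$ is *strongly zero product determined* if there is a constant $\alpha$ with $\operatorname{dist}(\varphi,\mathcal B^2_\pi(A;\mathbb C))\le\alpha|\varphi|_{zp}$ for all $\varphi\in\mathcal B^2(A;\mathbb C)$; the least such $\alpha\ge0$ is denoted $\alpha_A$. It has the *strong property $\mathbb B$* if there is a constant $\beta$ with $|\varphi|_b\le\beta|\varphi|_{zp}$ for all $\varphi\in\mathcal B^2(A;\mathbb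 C)$; the least such $\beta\ge0$ is denoted $\beta_A$. A finite biorthogonal system for $X$ consists of $x_1,\dots,x_n\in X$ and $\phi_1,\dots,\phi_n\in X^*$ with $\phi_k(x_j)=\delta_{j,k}$; it defines an algebra homomorphism $\theta$ from the matrix algebra $\mathbb M_n(\mathbb C)$ to the finite-rank operators on $X$ by $\theta\bigl((a_{j,k})\bigr)y=\sum_{j,k}a_{j,k}\,\phi_k(y)\,x_j$. The space $X$ has *property $(\mathbb A)$* if there are a non-empty directed set $\Lambda$ and, for each $\lambda\in\Lambda$, a finite biorthogonal system of some size $n_\lambda$, with homomorphism $\theta_\lambda$, and a finite subgroup $G_\lambda$ of $GL_{n_\lambda}(\mathbb C)$ whose linear span is $\mathbb M_{n_\lambda}(\mathbb C)$, such that $\theta_\lambda(I_{n_\lambda})\to I_X$ uniformly on compact subsets of $X$, $\theta_\lambda(I_{n_\lambda})^*\to I_{X^*}$ uniformly on compact subsets of $X^*$, and $$C:=\sup_{\lambda\in\Lambda}\ \sup_{t\in G_\lambda}\|\theta_\lambda(t)\|<\infty .$$ **Theorem 4.1.** If $X$ has property $(\mathbb A)$, then $\mathcal A(X)$ is strongly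 zero product determined and has the strong property $\mathbb B$. Moreover, for every choice of $\Lambda$, the biorthogonal systems and the groups $G_\lambda$ as in the definition of property $(\mathbb A)$, with corresponding supremum $C$, $$\tfrac12\,\beta_{\mathcal A(X)}\ \le\ \alpha_{\mathcal A(X)}\ \le\ 60\sqrt{27}\;\frac{1+\sin\frac{\pi}{10}}{1-2\sin\frac{\pi}{10}}\;C^2 .$$ -/

import Mathlib

open Filter Topology

universe u w

/-! ### Zero product determined Banach algebras -/

section BanachAlgebra

variable (A : Type u) [NonUnitalNormedRing A] [NormedSpace ℂ A]

/-- The set of continuous bilinear functionals on `A` of the form `(a, b) ↦ ξ (a * b)`, with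
`ξ` in the dual of `A`. The space of all continuous bilinear functionals is
`A →L[ℂ] A →L[ℂ] ℂ`, whose operator norm is the usual norm of a bilinear functional. -/
def productFunctionals : Set (A →L[ℂ] A →L[ℂ] ℂ) :=
  {ψ | ∃ ξ : StrongDual ℂ A, ∀ a b : A, ψ a b = ξ (a * b)}

variable {A}

/-- The constant `|φ|_b`. -/
noncomputable def balancedSeminorm (φ : A →L[ℂ] A →L[ℂ] ℂ) : ℝ :=
  sSup {r : ℝ | ∃ a b c : A, ‖a‖ = 1 ∧ ‖b‖ = 1 ∧ ‖c‖ = 1 ∧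
    r = ‖φ (a * b) c - φ a (b * c)‖}

/-- The constant `|φ|_zp`; it is `0` when there are no pairs of norm-one elements with zero
product. -/
noncomputable def zeroProductSeminorm (φ : A →L[ℂ] A →L[ℂ] ℂ) : ℝ :=
  sSup {r : ℝ | ∃ a b : A, ‖a‖ = 1 ∧ ‖b‖ = 1 ∧ a * b = 0 ∧ r = ‖φ a b‖}

variable (A)

/-- The estimate `dist (φ, B²_π(A; ℂ)) ≤ α |φ|_zp` for all continuous bilinear functionals. -/
def DistanceEstimate (α : ℝ) : Prop :=
  ∀ φ : A →L[ℂ] A →L[ℂ] ℂ,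
    Metric.infDist φ (productFunctionals A) ≤ α * zeroProductSeminorm φ

/-- The estimate `|φ|_b ≤ β |φ|_zp` for all continuous bilinear functionals. -/
def BalancedEstimate (β : ℝ) : Prop :=
  ∀ φ : A →L[ℂ] A →L[ℂ] ℂ, balancedSeminorm φ ≤ β * zeroProductSeminorm φ

/-- `A` is strongly zero product determined. -/
def StronglyZeroProductDetermined : Prop :=
  ∃ α : ℝ, DistanceEstimate A α

/-- `A` has the strong property `𝔹`. -/
def StrongPropertyB : Prop :=
  ∃ β : ℝ, BalancedEstimate A β

/-- The optimal constant `α_A`: the least `α ≥ 0` in the distance estimate (the set is closed,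
so the infimum is attained when `A` is strongly zero product determined). -/
noncomputable def alphaConst : ℝ :=
  sInf {α : ℝ | 0 ≤ α ∧ DistanceEstimate A α}

/-- The optimal constant `β_A`: the least `β ≥ 0` in the estimate of the strong
property `𝔹` (attained when `A` has that property). -/
noncomputable def betaConst : ℝ :=
  sInf {β : ℝ | 0 ≤ β ∧ BalancedEstimate A β}

end BanachAlgebra

/-! ### Approximable operators -/

section Operators

variable (X : Type u) [NormedAddCommGroup X] [NormedSpace ℂ X]

/-- A non-unital subalgebra of a complex normed algebra is a normed space for the restricted
norm. -/
instance NonUnitalSubalgebra.complexNormedSpace {E : Type*} [NonUnitalNormedRing E]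
    [NormedSpace ℂ E] (s : NonUnitalSubalgebra ℂ E) : NormedSpace ℂ s where
  norm_smul_le c x := norm_smul_le c (x : E)

/-- The algebra `F(X)` of continuous finite-rank operators on `X`. -/
def finiteRankOperators : NonUnitalSubalgebra ℂ (X →L[ℂ] X) where
  carrier := {T | (T : X →ₗ[ℂ] X).HasFiniteRange}
  zero_mem' := LinearMap.HasFiniteRange.zero
  add_mem' hS hT := LinearMap.HasFiniteRange.add hS hT
  mul_mem' hS _ := LinearMap.HasFiniteRange.comp_right hS _
  smul_mem' c _ hT := LinearMap.HasFiniteRange.smul hT c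

/-- The algebra `A(X)` of approximable operators: the operator-norm closure of `F(X)`. -/
noncomputable def approximableOperators : NonUnitalSubalgebra ℂ (X →L[ℂ] X) :=
  (finiteRankOperators X).topologicalClosure

/-- A finite biorthogonal system of size `n` for `X`. -/
structure BiorthogonalSystem (n : ℕ) where
  vec : Fin n → X
  functional : Fin n → StrongDual ℂ X
  biorthogonal : ∀ j k : Fin n, functional k (vec j) = if j = k then 1 else 0

variable {X}

/-- The map `θ : 𝕄_n → F(X)`, `(a_{jk}) ↦ ∑ a_{jk} x_j ⊗ φ_k`, where
`(x ⊗ φ) y = φ y • x`. -/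
noncomputable def BiorthogonalSystem.theta {n : ℕ} (B : BiorthogonalSystem X n)
    (a : Matrix (Fin n) (Fin n) ℂ) : X →L[ℂ] X :=
  ∑ j, ∑ k, a j k • (B.functional k).smulRight (B.vec j)

variable (X)

/-- A system, indexed by the directed set `Λ`, of finite biorthogonal systems and finite matrix
groups as required in the definition of property `(𝔸)`. -/
structure PropertyASystem (Λ : Type w) [Preorder Λ] where
  size : Λ → ℕ
  sys : ∀ i : Λ, BiorthogonalSystem X (size i)
  grp : ∀ i : Λ, Subgroup (GL (Fin (size i)) ℂ)
  /-- `θ_i(I) → I_X` uniformly on compact subsets of `X`. -/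
  tendsto_id : ∀ K : Set X, IsCompact K →
    TendstoUniformlyOn (fun (i : Λ) (y : X) => (sys i).theta 1 y) (fun y => y) atTop K
  /-- `θ_i(I)^* → I_{X^*}` uniformly on norm-compact subsets of `X^*`; the adjoint of `T`
  is `ψ ↦ ψ ∘ T`. -/
  tendsto_adjoint : ∀ K : Set (StrongDual ℂ X), IsCompact K →
    TendstoUniformlyOn (fun (i : Λ) (ψ : StrongDual ℂ X) => ψ.comp ((sys i).theta 1))
      (fun ψ => ψ) atTop K
  finite_grp : ∀ i : Λ, Finite (grp i)
  span_grp : ∀ i : Λ, Submodule.span ℂ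
    {a : Matrix (Fin (size i)) (Fin (size i)) ℂ | ∃ t ∈ grp i, a = t} = ⊤
  bounded : BddAbove {r : ℝ | ∃ i : Λ, ∃ t ∈ grp i, r = ‖(sys i).theta t‖}

variable {X}

/-- The supremum `C` of the norms `‖θ_i(t)‖` over all `i ∈ Λ` and `t ∈ G_i`. -/
noncomputable def PropertyASystem.bound {Λ : Type w} [Preorder Λ]
    (S : PropertyASystem X Λ) : ℝ :=
  sSup {r : ℝ | ∃ i : Λ, ∃ t ∈ S.grp i, r = ‖(S.sys i).theta t‖}

variable (X)

/-- Property `(𝔸)`, with a non-empty directed index set in the universe `w`. -/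
def HasPropertyA : Prop :=
  ∃ (Λ : Type w) (_ : Preorder Λ) (_ : IsDirectedOrder Λ) (_ : Nonempty Λ),
    Nonempty (PropertyASystem X Λ)

end Operators

/-!
The proof is a quantitative form of averaging over a group. Let `ρ : G → A(X)` be the restriction of
`θ` to one of the finite groups, with `‖ρ(t)‖ ≤ C`. Since `G` spans the matrix algebra,
`|G|⁻¹ ∑ₜ ρ(t) ⊗ ρ(t⁻¹)` commutes with the range of `θ`, so for `b` in that range
`|G|⁻¹ ∑ₜ φ(a ρ(t), ρ(t⁻¹) b)` is a functional of the product `a b`. It is thus enough to show that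
`W(t, t⁻¹) = φ(a ρ(t), ρ(t⁻¹) b)` differs from `W(1, 1)` by at most a universal multiple of
`C² ‖a‖ ‖b‖ |φ|_zp` (`norm_translate_sub_le`). The functionals obtained from the different indices are
bounded, and a weak-* limit of them along an ultrafilter is the functional required
(`distanceEstimate_of_group_images`); the units `θ(I)` form a bounded two-sided approximate
identity of `A(X)`, which takes `φ(a θ(I), θ(I) b)` to `φ(a, b)`.

The universal estimate concerns one cyclic group, written as an image of `ZMod L` with `L` a large
multiple of `|G|`. Elements `f, g` of `ℓ¹(ZMod L)` with `f * g = 0` give operators with zero product,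
so averaging over the characters bounds `∑ⱼ f(j) g(-j) H(j)`, where `H(j) = W(tʲ, t⁻ʲ)`, by
`M ‖f‖₁ ‖g‖₁`. Take for the Fourier transform of `f` a triangle function on a short arc and for that
of `g` the function `1 - V`, with `V` a trapezoid equal to `1` on that arc. The estimate then
says that `H(0)`, and likewise `H(1)`, is close to an average of nearby values of `H`, the two
averages being shifts of each other (`norm_sub_sum_averagingWeight_le`). If the arc is short, the
weights have small total variation (`sum_norm_averagingWeight_sub_le`), so
`‖H(1) - H(0)‖ ≤ K M + ε S` with `ε < 1`, where `S` is the largest of the numbers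
`‖W(t, t⁻¹) - W(1, 1)‖`, `t ∈ G`. Choosing `t` to attain this maximum gives `S ≤ K M / (1 - ε)`
(`norm_sub_le_of_finite_group`). All the `ℓ¹` bounds come from Parseval's identity and the
Cauchy–Schwarz inequality. The resulting constant `720` is below the one in the theorem, which
exceeds `900`.

The inequality between the two optimal constants holds because `|φ|_b` does not change when a
functional of the form `ξ(ab)` is subtracted from `φ`, and is at most `2 ‖φ‖`.
-/

/-! ### Exponential sums over `ZMod L` -/

lemma sum_stdAddChar_mul {L : ℕ} [NeZero L] (b : ZMod L) :
    ∑ j : ZMod L, ZMod.stdAddChar (j * b) = if b = 0 then (L : ℂ) else 0 := by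
  rw [AddChar.sum_mulShift b (ZMod.isPrimitive_stdAddChar L), ZMod.card]
  split_ifs <;> simp

lemma conj_stdAddChar {L : ℕ} [NeZero L] (x : ZMod L) :
    (starRingEnd ℂ) (ZMod.stdAddChar x) = ZMod.stdAddChar (-x) := by
  rw [ZMod.stdAddChar_apply, ZMod.stdAddChar_apply, AddChar.map_neg_eq_inv, Circle.coe_inv_eq_conj]

/-- Parseval's identity on `ZMod L`. -/
lemma sum_norm_sq_stdAddChar {L : ℕ} [NeZero L] (c : ZMod L → ℂ) (I : Finset (ZMod L)) :
    ∑ j : ZMod L, ‖∑ x ∈ I, c x * ZMod.stdAddChar (j * x)‖ ^ 2 = L * ∑ x ∈ I, ‖c x‖ ^ 2 := by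
  have key : ∀ j : ZMod L, ((‖∑ x ∈ I, c x * ZMod.stdAddChar (j * x)‖ ^ 2 : ℝ) : ℂ) =
      ∑ x ∈ I, ∑ y ∈ I, c x * (starRingEnd ℂ) (c y) * ZMod.stdAddChar (j * (x - y)) := by
    intro j
    rw [← Complex.normSq_eq_norm_sq, ← Complex.mul_conj, map_sum, Finset.sum_mul_sum]
    refine Finset.sum_congr rfl fun x _ => Finset.sum_congr rfl fun y _ => ?_
    rw [map_mul (starRingEnd ℂ), conj_stdAddChar, mul_sub, sub_eq_add_neg, AddChar.map_add_eq_mul]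
    ring
  have : ((∑ j : ZMod L, ‖∑ x ∈ I, c x * ZMod.stdAddChar (j * x)‖ ^ 2 : ℝ) : ℂ) =
      ((L * ∑ x ∈ I, ‖c x‖ ^ 2 : ℝ) : ℂ) := by
    rw [Complex.ofReal_sum, Finset.sum_congr rfl fun j _ => key j, Finset.sum_comm]
    simp_rw [Finset.sum_comm (s := Finset.univ) (t := I), ← Finset.mul_sum, sum_stdAddChar_mul,
      sub_eq_zero]
    push_cast
    rw [Finset.mul_sum]
    refine Finset.sum_congr rfl fun x hx => ?_
    simp only [mul_ite, mul_zero, Finset.sum_ite_eq, hx, if_true, Complex.mul_conj,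
      Complex.normSq_eq_norm_sq]
    push_cast
    ring
  exact_mod_cast this

/-- The exponential sum `j ↦ ∑_{x ∈ I} e(j x / L)` of a set `I` of residues. -/
noncomputable def expSum {L : ℕ} [NeZero L] (I : Finset (ZMod L)) (j : ZMod L) : ℂ :=
  ∑ x ∈ I, ZMod.stdAddChar (j * x)

lemma sum_norm_expSum_sq {L : ℕ} [NeZero L] (I : Finset (ZMod L)) :
    ∑ j, ‖expSum I j‖ ^ 2 = L * I.card := by
  simpa [expSum] using sum_norm_sq_stdAddChar (fun _ => 1) I

lemma expSum_zero {L : ℕ} [NeZero L] (I : Finset (ZMod L)) : expSum I 0 = I.card := by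
  simp [expSum]

lemma norm_stdAddChar {L : ℕ} [NeZero L] (x : ZMod L) : ‖(ZMod.stdAddChar x : ℂ)‖ = 1 := by
  rw [ZMod.stdAddChar_apply]
  exact Circle.norm_coe _

lemma norm_expSum_le {L : ℕ} [NeZero L] (I : Finset (ZMod L)) (j : ZMod L) :
    ‖expSum I j‖ ≤ I.card := by
  refine (norm_sum_le _ _).trans ?_
  simp

lemma sum_norm_expSum_sub_sq_le {L : ℕ} [NeZero L] (I : Finset (ZMod L)) {δ : ℝ}
    (hI : ∀ x ∈ I, ‖(ZMod.stdAddChar x : ℂ) - 1‖ ≤ δ) :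
    ∑ j, ‖expSum I (j + 1) - expSum I j‖ ^ 2 ≤ L * I.card * δ ^ 2 := by
  have h : ∀ j, expSum I (j + 1) - expSum I j =
      ∑ x ∈ I, ((ZMod.stdAddChar x : ℂ) - 1) * ZMod.stdAddChar (j * x) := by
    intro j
    simp only [expSum, ← Finset.sum_sub_distrib]
    refine Finset.sum_congr rfl fun x _ => ?_
    rw [add_mul, AddChar.map_add_eq_mul, one_mul]
    ring
  simp_rw [h]
  rw [sum_norm_sq_stdAddChar, mul_assoc]
  gcongr
  calc ∑ x ∈ I, ‖(ZMod.stdAddChar x : ℂ) - 1‖ ^ 2 ≤ ∑ x ∈ I, δ ^ 2 := by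
        gcongr with x hx
        exact hI x hx
    _ = _ := by simp

/-- The product of the exponential sums of `I` and `J` is the Fourier transform of a multiple of
the function counting the representations `x = y + z`, `y ∈ I`, `z ∈ J`; if `J ⊇ I + I - I`, that
count is constant on the support `I + I` of the function with transform `(expSum I) ^ 2`. -/
lemma sum_expSum_sq_mul {L : ℕ} [NeZero L] {I J : Finset (ZMod L)}
    (hIJ : ∀ x ∈ I, ∀ y ∈ I, ∀ z ∈ I, x + y - z ∈ J) (n : ZMod L) :
    ∑ j, expSum I j ^ 2 * (expSum I (n - j) * expSum J (n - j)) =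
      L * I.card * expSum I n ^ 2 := by
  have h : ∀ j, expSum I j ^ 2 * (expSum I (n - j) * expSum J (n - j)) =
      ∑ x ∈ I, ∑ x' ∈ I, ∑ y ∈ I, ∑ z ∈ J,
        ZMod.stdAddChar (n * (y + z)) * ZMod.stdAddChar (j * ((x + x') - (y + z))) := by
    intro j
    simp only [expSum, sq, Finset.sum_mul_sum]
    refine Finset.sum_congr rfl fun x _ => ?_
    rw [Finset.sum_comm]
    refine Finset.sum_congr rfl fun x' _ => Finset.sum_congr rfl fun y _ =>
      Finset.sum_congr rfl fun z _ => ?_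
    simp only [← AddChar.map_add_eq_mul]
    congr 1
    ring
  simp_rw [h]
  rw [Finset.sum_comm]
  simp_rw [Finset.sum_comm (s := Finset.univ), ← Finset.mul_sum, sum_stdAddChar_mul]
  rw [expSum, sq, Finset.sum_mul_sum, Finset.mul_sum]
  refine Finset.sum_congr rfl fun x hx => ?_
  rw [Finset.mul_sum]
  refine Finset.sum_congr rfl fun x' hx' => ?_
  have h2 : ∀ y ∈ I, ∑ z ∈ J, (ZMod.stdAddChar (n * (y + z)) : ℂ) *
      (if x + x' - (y + z) = 0 then (L : ℂ) else 0) = L * ZMod.stdAddChar (n * (x + x')) := by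
    intro y hy
    rw [Finset.sum_eq_single (x + x' - y)]
    · rw [if_pos (by ring), mul_comm]
      congr 3
      ring
    · intro z _ hz
      rw [if_neg, mul_zero]
      intro h0
      exact hz (by linear_combination -h0)
    · intro h0
      exact absurd (hIJ x hx x' hx' y hy) h0
  rw [Finset.sum_congr rfl h2, Finset.sum_const, nsmul_eq_mul, mul_add, AddChar.map_add_eq_mul]
  ring

/-- Cauchy–Schwarz for sums of products of norms. -/
lemma sum_norm_mul_norm_le {ι : Type*} [Fintype ι] {f g : ι → ℂ} {a b c : ℝ} (hc : 0 ≤ c)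
    (hf : ∑ j, ‖f j‖ ^ 2 ≤ a) (hg : ∑ j, ‖g j‖ ^ 2 ≤ b) (hab : a * b ≤ c ^ 2) :
    ∑ j, ‖f j‖ * ‖g j‖ ≤ c := by
  have h0 : 0 ≤ ∑ j, ‖f j‖ ^ 2 := by positivity
  have h1 : 0 ≤ ∑ j, ‖g j‖ ^ 2 := by positivity
  refine abs_le_of_sq_le_sq' ?_ hc |>.2
  refine (Finset.sum_mul_sq_le_sq_mul_sq _ _ _).trans (le_trans ?_ hab)
  gcongr
  exact h0.trans hf

/-! ### Approximate averages of functions on `ZMod L` -/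

/-- The weight `f(j) v(-j)`, where `f = (expSum I) ^ 2` and `v = expSum I * expSum J`. Up to
normalization `f` and `v` have as Fourier transforms a triangle function with support `I + I` and a
trapezoid which is constant there, provided that `J ⊇ I + I - I`. -/
noncomputable def averagingWeight {L : ℕ} [NeZero L] (I J : Finset (ZMod L)) (j : ZMod L) : ℂ :=
  expSum I j ^ 2 * (expSum I (-j) * expSum J (-j))

/-- The total variation of the weights is small compared with their sum `L * #I ^ 3`, if the residues
in `I` and `J` are close to `0`. -/
lemma sum_norm_averagingWeight_sub_le {L : ℕ} [NeZero L] {I J : Finset (ZMod L)} {δ : ℝ}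
    (hδ : 0 ≤ δ) (hJ : J.card ≤ 3 * I.card)
    (hδI : ∀ x ∈ I, ‖(ZMod.stdAddChar x : ℂ) - 1‖ ≤ δ)
    (hδJ : ∀ x ∈ J, ‖(ZMod.stdAddChar x : ℂ) - 1‖ ≤ 3 * δ) :
    ∑ j, ‖averagingWeight I J (j + 1) - averagingWeight I J j‖ ≤
      6 * √3 * δ * (L * (I.card : ℝ) ^ 3) := by
  set r : ℝ := (I.card : ℝ) with hr
  have hr0 : 0 ≤ r := by positivity
  have hJr : (J.card : ℝ) ≤ 3 * r := by rw [hr]; exact_mod_cast hJ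
  have hL : (0 : ℝ) ≤ L := by positivity
  have h3 : √3 ^ 2 = 3 := Real.sq_sqrt (by norm_num)
  -- the reflection `j ↦ - (j + 1)` exchanges the two arguments of a difference
  let e : ZMod L ≃ ZMod L := (Equiv.addRight 1).trans (Equiv.neg _)
  have hneg : ∀ K : Finset (ZMod L), ∑ j, ‖expSum K (-(j + 1)) - expSum K (-j)‖ ^ 2 =
      ∑ j, ‖expSum K (j + 1) - expSum K j‖ ^ 2 := by
    intro K
    rw [← Equiv.sum_comp e]
    refine Finset.sum_congr rfl fun j _ => ?_
    have h1 : e j = -(j + 1) := rfl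
    rw [h1, norm_sub_rev]
    congr 4 <;> ring
  have hIs : ∑ j, ‖expSum I (-j)‖ ^ 2 ≤ L * r :=
    (Equiv.sum_comp (Equiv.neg (ZMod L)) fun j => ‖expSum I j‖ ^ 2).trans_le
      (sum_norm_expSum_sq I).le
  have hJs : ∑ j, ‖expSum J (-(j + 1))‖ ^ 2 ≤ L * (3 * r) := by
    refine (Equiv.sum_comp e fun j => ‖expSum J j‖ ^ 2).trans_le ?_
    rw [sum_norm_expSum_sq J]
    gcongr
  have hdI := sum_norm_expSum_sub_sq_le I hδI
  have hdI' := (hneg I).trans_le hdI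
  have hdJ : ∑ j, ‖expSum J (-(j + 1)) - expSum J (-j)‖ ^ 2 ≤ L * (3 * r) * (3 * δ) ^ 2 := by
    refine (hneg J).trans_le ((sum_norm_expSum_sub_sq_le J hδJ).trans ?_)
    gcongr
  have s1 := sum_norm_mul_norm_le (c := √3 * L * r * δ) (by positivity) hdI hJs
    (le_of_eq (by rw [← hr]; linear_combination (-(L * r * δ) ^ 2) * h3))
  have s2 := sum_norm_mul_norm_le (c := √3 * L * r * δ) (by positivity) hdI' hJs
    (le_of_eq (by rw [← hr]; linear_combination (-(L * r * δ) ^ 2) * h3))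
  have s3 := sum_norm_mul_norm_le (c := 3 * √3 * L * r * δ) (by positivity) hIs hdJ
    (le_of_eq (by linear_combination (-9 * (L * r * δ) ^ 2) * h3))
  have hpt : ∀ j, ‖averagingWeight I J (j + 1) - averagingWeight I J j‖ ≤
      r ^ 2 * (2 * (‖expSum I (j + 1) - expSum I j‖ * ‖expSum J (-(j + 1))‖) +
        ‖expSum I (-(j + 1)) - expSum I (-j)‖ * ‖expSum J (-(j + 1))‖ +
        ‖expSum I (-j)‖ * ‖expSum J (-(j + 1)) - expSum J (-j)‖) := by
    intro j
    have ha := norm_expSum_le I j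
    have ha' := norm_expSum_le I (j + 1)
    have hb' := norm_expSum_le I (-(j + 1))
    unfold averagingWeight
    rw [← hr] at ha ha' hb'
    generalize expSum I j = a at *
    generalize expSum I (j + 1) = a' at *
    generalize expSum I (-j) = b at *
    generalize expSum I (-(j + 1)) = b' at *
    generalize expSum J (-j) = c at *
    generalize expSum J (-(j + 1)) = c' at *
    have : a' ^ 2 * (b' * c') - a ^ 2 * (b * c) = a' * b' * ((a' - a) * c') +
        a * b' * ((a' - a) * c') + a * a * ((b' - b) * c') + a * a * (b * (c' - c)) := by ring
    rw [this]
    refine (norm_add₄_le).trans ?_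
    simp only [norm_mul]
    have e1 : ‖a'‖ * ‖b'‖ * (‖a' - a‖ * ‖c'‖) ≤ r * r * (‖a' - a‖ * ‖c'‖) := by gcongr
    have e2 : ‖a‖ * ‖b'‖ * (‖a' - a‖ * ‖c'‖) ≤ r * r * (‖a' - a‖ * ‖c'‖) := by gcongr
    have e3 : ‖a‖ * ‖a‖ * (‖b' - b‖ * ‖c'‖) ≤ r * r * (‖b' - b‖ * ‖c'‖) := by gcongr
    have e4 : ‖a‖ * ‖a‖ * (‖b‖ * ‖c' - c‖) ≤ r * r * (‖b‖ * ‖c' - c‖) := by gcongr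
    linarith
  refine (Finset.sum_le_sum fun j _ => hpt j).trans ?_
  rw [← Finset.mul_sum, Finset.sum_add_distrib, Finset.sum_add_distrib, ← Finset.mul_sum]
  have : r ^ 2 * (2 * (√3 * L * r * δ) + √3 * L * r * δ + 3 * √3 * L * r * δ) =
    6 * √3 * δ * (L * r ^ 3) := by ring
  rw [← this]
  gcongr

/-- A function `H` on `ZMod L` such that `∑ⱼ f(j) g(-j) H(j)` is small whenever `f * g = 0` has at `0`
nearly the value of its average with weights `averagingWeight I J`. -/
lemma norm_sub_sum_averagingWeight_le {L : ℕ} [NeZero L] {H : ZMod L → ℂ} {M : ℝ} (hM : 0 ≤ M)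
    {I J : Finset (ZMod L)} (hJ : J.card ≤ 3 * I.card)
    (hIJ : ∀ x ∈ I, ∀ y ∈ I, ∀ z ∈ I, x + y - z ∈ J)
    (hH : ∀ f g : ZMod L → ℂ, (∀ n, ∑ j, f j * g (n - j) = 0) →
      ‖∑ j, f j * g (-j) * H j‖ ≤ M * (∑ j, ‖f j‖) * (∑ j, ‖g j‖)) :
    ‖L * (I.card : ℂ) ^ 3 * H 0 - ∑ j, averagingWeight I J j * H j‖ ≤
      (1 + √3) * M * (L * (I.card : ℝ)) ^ 2 := by
  set r : ℝ := (I.card : ℝ) with hr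
  have hr0 : 0 ≤ r := by positivity
  have hJr : (J.card : ℝ) ≤ 3 * r := by rw [hr]; exact_mod_cast hJ
  have hL : (0 : ℝ) ≤ L := by positivity
  have h3 : √3 ^ 2 = 3 := Real.sq_sqrt (by norm_num)
  -- `g` is a multiple of `δ₀ - v`, so that its Fourier transform vanishes on the support of that of `f`
  let f : ZMod L → ℂ := fun j => expSum I j ^ 2
  let g : ZMod L → ℂ := fun j => (if j = 0 then (L * I.card : ℂ) else 0) - expSum I j * expSum J j
  have hfg : ∀ n, ∑ j, f j * g (n - j) = 0 := by
    intro n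
    simp only [f, g, mul_sub, Finset.sum_sub_distrib, sum_expSum_sq_mul hIJ n, sub_eq_zero (a := n),
      mul_ite, mul_zero, Finset.sum_ite_eq, Finset.mem_univ, if_true]
    ring
  have hf : ∑ j, ‖f j‖ = L * r := by
    simp only [f, norm_pow, sum_norm_expSum_sq, ← hr]
  have hv : ∑ j, ‖expSum I j‖ * ‖expSum J j‖ ≤ √3 * (L * r) := by
    refine sum_norm_mul_norm_le (by positivity) (sum_norm_expSum_sq I).le
      (b := L * (3 * r)) ?_ (le_of_eq ?_)
    · rw [sum_norm_expSum_sq J]; gcongr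
    · rw [← hr]; linear_combination (-(L * r) ^ 2) * h3
  have hg : ∑ j, ‖g j‖ ≤ (1 + √3) * (L * r) := by
    calc ∑ j, ‖g j‖ ≤ ∑ j, ((if j = 0 then L * r else 0) + ‖expSum I j‖ * ‖expSum J j‖) := by
          refine Finset.sum_le_sum fun j _ => (norm_sub_le _ _).trans_eq ?_
          rw [norm_mul]
          congr 1
          split_ifs <;> simp [hr]
      _ ≤ L * r + √3 * (L * r) := by
          rw [Finset.sum_add_distrib]
          gcongr
          simp
      _ = _ := by ring
  have hsum : ∑ j, f j * g (-j) * H j =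
      L * (I.card : ℂ) ^ 3 * H 0 - ∑ j, averagingWeight I J j * H j := by
    simp only [f, g, mul_sub, sub_mul, Finset.sum_sub_distrib, neg_eq_zero, mul_ite, mul_zero,
      ite_mul, zero_mul, Finset.sum_ite_eq', Finset.mem_univ, if_true, expSum_zero,
      averagingWeight]
    ring
  rw [← hsum]
  refine (hH f g hfg).trans ?_
  rw [hf]
  calc M * (L * r) * ∑ j, ‖g j‖ ≤ M * (L * r) * ((1 + √3) * (L * r)) := by gcongr
    _ = _ := by ring

/-- Both `H` and its shift satisfy `norm_sub_sum_averagingWeight_le`; the difference of their averages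
is controlled by the total variation of the weights. -/
lemma norm_sub_le_of_convolution {L : ℕ} [NeZero L] {H : ZMod L → ℂ} {M S δ : ℝ}
    (hM : 0 ≤ M) (hδ : 0 ≤ δ) {I J : Finset (ZMod L)} (hI : I.Nonempty)
    (hJ : J.card ≤ 3 * I.card) (hIJ : ∀ x ∈ I, ∀ y ∈ I, ∀ z ∈ I, x + y - z ∈ J)
    (hδI : ∀ x ∈ I, ‖(ZMod.stdAddChar x : ℂ) - 1‖ ≤ δ)
    (hδJ : ∀ x ∈ J, ‖(ZMod.stdAddChar x : ℂ) - 1‖ ≤ 3 * δ)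
    (hH : ∀ f g : ZMod L → ℂ, (∀ n, ∑ j, f j * g (n - j) = 0) →
      ‖∑ j, f j * g (-j) * H j‖ ≤ M * (∑ j, ‖f j‖) * (∑ j, ‖g j‖))
    (hS : ∀ j, ‖H j - H 0‖ ≤ S) :
    ‖H 1 - H 0‖ ≤ 2 * (1 + √3) * (L / I.card) * M + 6 * √3 * δ * S := by
  have hr : (0 : ℝ) < I.card := by exact_mod_cast hI.card_pos
  have hL : (0 : ℝ) < L := by exact_mod_cast Nat.pos_of_ne_zero (NeZero.ne L)
  have hS0 : 0 ≤ S := (norm_nonneg _).trans (hS 0)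
  have hH1 : ∀ f g : ZMod L → ℂ, (∀ n, ∑ j, f j * g (n - j) = 0) →
      ‖∑ j, f j * g (-j) * H (j + 1)‖ ≤ M * (∑ j, ‖f j‖) * (∑ j, ‖g j‖) := by
    intro f g hfg
    have h := hH (fun j => f (j - 1)) (fun j => g (j + 1)) fun n => by
      rw [← hfg n, ← Equiv.sum_comp (Equiv.addRight (1 : ZMod L))]
      refine Finset.sum_congr rfl fun j _ => ?_
      simp only [Equiv.coe_addRight]
      congr 2 <;> ring
    rw [← Equiv.sum_comp (Equiv.addRight (1 : ZMod L))] at h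
    have e1 : ∑ j, ‖f (j - 1)‖ = ∑ j, ‖f j‖ :=
      Equiv.sum_comp (Equiv.subRight (1 : ZMod L)) fun j => ‖f j‖
    have e2 : ∑ j, ‖g (j + 1)‖ = ∑ j, ‖g j‖ :=
      Equiv.sum_comp (Equiv.addRight (1 : ZMod L)) fun j => ‖g j‖
    rw [e1, e2] at h
    refine le_of_eq_of_le ?_ h
    congr 1
    refine Finset.sum_congr rfl fun j _ => ?_
    simp only [Equiv.coe_addRight]
    congr 3 <;> ring
  have b0 := norm_sub_sum_averagingWeight_le hM hJ hIJ hH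
  have b1 := norm_sub_sum_averagingWeight_le hM hJ hIJ hH1
  rw [zero_add] at b1
  have b2 := sum_norm_averagingWeight_sub_le hδ hJ hδI hδJ
  -- summation by parts moves the shift of `H` onto the weights; constants do not contribute
  have hdiff : ∑ j, averagingWeight I J j * H j - ∑ j, averagingWeight I J j * H (j + 1) =
      ∑ j, (averagingWeight I J (j + 1) - averagingWeight I J j) * (H (j + 1) - H 0) := by
    have e1 := Equiv.sum_comp (Equiv.addRight (1 : ZMod L)) fun j => averagingWeight I J j * H j
    have e2 := Equiv.sum_comp (Equiv.addRight (1 : ZMod L)) fun j => averagingWeight I J j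
    simp only [Equiv.coe_addRight] at e1 e2
    simp only [mul_sub, sub_mul, Finset.sum_sub_distrib, e1, ← Finset.sum_mul, e2]
    ring
  have b3 : ‖∑ j, averagingWeight I J j * H j - ∑ j, averagingWeight I J j * H (j + 1)‖ ≤
      6 * √3 * δ * (L * (I.card : ℝ) ^ 3) * S := by
    rw [hdiff]
    refine (norm_sum_le _ _).trans ?_
    calc _ ≤ ∑ j, ‖averagingWeight I J (j + 1) - averagingWeight I J j‖ * S := by
          refine Finset.sum_le_sum fun j _ => ?_
          rw [norm_mul]
          gcongr
          exact hS _
      _ ≤ _ := by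
          rw [← Finset.sum_mul]
          gcongr
  have hmain : L * (I.card : ℝ) ^ 3 * ‖H 1 - H 0‖ ≤
      2 * ((1 + √3) * M * (L * (I.card : ℝ)) ^ 2) + 6 * √3 * δ * (L * (I.card : ℝ) ^ 3) * S := by
    have : L * (I.card : ℝ) ^ 3 * ‖H 1 - H 0‖ = ‖(L * (I.card : ℂ) ^ 3) * (H 1 - H 0)‖ := by
      rw [norm_mul, norm_mul, norm_pow, Complex.norm_natCast, Complex.norm_natCast]
    rw [this]
    have e : (L * (I.card : ℂ) ^ 3) * (H 1 - H 0) =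
      (L * (I.card : ℂ) ^ 3 * H 1 - ∑ j, averagingWeight I J j * H (j + 1)) -
      (L * (I.card : ℂ) ^ 3 * H 0 - ∑ j, averagingWeight I J j * H j) -
      (∑ j, averagingWeight I J j * H j - ∑ j, averagingWeight I J j * H (j + 1)) := by ring
    rw [e]
    refine (norm_sub_le _ _).trans ((add_le_add (norm_sub_le _ _) b3).trans ?_)
    linarith
  have hpos : 0 < L * (I.card : ℝ) ^ 3 := by positivity
  refine le_of_mul_le_mul_left (hmain.trans_eq ?_) hpos
  field_simp

/-! ### An estimate for finite groups -/

lemma norm_stdAddChar_intCast_sub_one_le {L : ℕ} [NeZero L] (k : ℤ) :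
    ‖(ZMod.stdAddChar (k : ZMod L) : ℂ) - 1‖ ≤ 2 * Real.pi * |(k : ℝ)| / L := by
  have : (2 * Real.pi * Complex.I * k / L : ℂ) =
      Complex.I * ((2 * Real.pi * k / L : ℝ) : ℂ) := by
    push_cast; ring
  rw [ZMod.stdAddChar_coe, this]
  refine Real.norm_exp_I_mul_ofReal_sub_one_le.trans_eq ?_
  rw [Real.norm_eq_abs, abs_div, abs_mul, abs_mul, abs_of_pos Real.pi_pos, Nat.abs_cast,
    abs_of_pos (zero_lt_two' ℝ)]

/-- The residues modulo `L` of the integers of absolute value at most `a`. -/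
noncomputable def residueInterval (L a : ℕ) : Finset (ZMod L) :=
  (Finset.Icc (-(a : ℤ)) a).image (fun k : ℤ => (k : ZMod L))

lemma card_residueInterval_le (L a : ℕ) : (residueInterval L a).card ≤ 2 * a + 1 := by
  refine Finset.card_image_le.trans ?_
  rw [Int.card_Icc]
  omega

lemma card_residueInterval {L a : ℕ} (h : 2 * a < L) :
    (residueInterval L a).card = 2 * a + 1 := by
  rw [residueInterval, Finset.card_image_of_injOn, Int.card_Icc]
  · omega
  · intro x hx y hy hxy
    rw [Finset.coe_Icc, Set.mem_Icc] at hx hy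
    have h1 := (ZMod.intCast_eq_intCast_iff_dvd_sub x y L).1 hxy
    have h2 := Int.eq_zero_of_abs_lt_dvd h1 (by rw [abs_lt]; omega)
    omega

lemma norm_stdAddChar_sub_one_le_of_mem_residueInterval {L a : ℕ} [NeZero L] {x : ZMod L}
    (hx : x ∈ residueInterval L a) :
    ‖(ZMod.stdAddChar x : ℂ) - 1‖ ≤ 2 * Real.pi * a / L := by
  obtain ⟨k, hk, rfl⟩ := Finset.mem_image.1 hx
  rw [Finset.mem_Icc] at hk
  refine (norm_stdAddChar_intCast_sub_one_le k).trans ?_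
  have : |(k : ℝ)| ≤ a := by
    rw [abs_le]
    exact_mod_cast hk
  have := Real.pi_pos
  gcongr

/-- With `I` an interval of length about `L / 65`, `norm_sub_le_of_convolution` gives a coefficient of
`S` below `1`. -/
lemma norm_sub_le_of_convolution_of_eq_mul {L N : ℕ} [NeZero L] (hN : 0 < N) (hL : L = 130 * N)
    {H : ZMod L → ℂ} {M S : ℝ} (hM : 0 ≤ M)
    (hH : ∀ f g : ZMod L → ℂ, (∀ n, ∑ j, f j * g (n - j) = 0) →
      ‖∑ j, f j * g (-j) * H j‖ ≤ M * (∑ j, ‖f j‖) * (∑ j, ‖g j‖))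
    (hS : ∀ j, ‖H j - H 0‖ ≤ S) :
    ‖H 1 - H 0‖ ≤ 356 * M + 0.503 * S := by
  have hS0 : 0 ≤ S := (norm_nonneg _).trans (hS 0)
  have hcard : (residueInterval L N).card = 2 * N + 1 := card_residueInterval (by omega)
  have hN' : (0 : ℝ) < N := by exact_mod_cast hN
  have hLN : (L : ℝ) = 130 * N := by rw [hL]; push_cast; ring
  have hδ : 2 * Real.pi * N / L = 2 * Real.pi / 130 := by
    rw [hLN]; field_simp
  have h := norm_sub_le_of_convolution (δ := 2 * Real.pi / 130) (I := residueInterval L N)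
    (J := residueInterval L (3 * N)) hM (by positivity)
    (Finset.card_pos.1 (by omega)) (by have := card_residueInterval_le L (3 * N); omega)
    (by
      intro x hx y hy z hz
      obtain ⟨i, hi, rfl⟩ := Finset.mem_image.1 hx
      obtain ⟨j, hj, rfl⟩ := Finset.mem_image.1 hy
      obtain ⟨k, hk, rfl⟩ := Finset.mem_image.1 hz
      rw [Finset.mem_Icc] at hi hj hk
      refine Finset.mem_image.2 ⟨i + j - k, ?_, by push_cast; ring⟩
      rw [Finset.mem_Icc]
      push_cast
      omega)
    (fun x hx => hδ ▸ norm_stdAddChar_sub_one_le_of_mem_residueInterval hx)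
    (fun x hx => by
      have := norm_stdAddChar_sub_one_le_of_mem_residueInterval hx
      refine this.trans_eq ?_
      rw [← hδ]
      push_cast
      ring) hH hS
  have h3 : √3 ≤ 1.7321 := Real.sqrt_le_iff.2 ⟨by norm_num, by norm_num⟩
  have h30 : 0 ≤ √3 := Real.sqrt_nonneg 3
  have hπ := Real.pi_lt_d4
  have hc : (L : ℝ) / (residueInterval L N).card ≤ 65 := by
    rw [hcard, hLN, div_le_iff₀ (by positivity)]
    push_cast
    linarith
  have e1 : 2 * (1 + √3) * ((L : ℝ) / (residueInterval L N).card) * M ≤ 356 * M := by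
    have : 2 * (1 + √3) * ((L : ℝ) / (residueInterval L N).card) ≤ 2 * (1 + 1.7321) * 65 := by
      gcongr
    gcongr
    linarith
  have e2 : 6 * √3 * (2 * Real.pi / 130) * S ≤ 0.503 * S := by
    have : 6 * √3 * (2 * Real.pi / 130) ≤ 6 * 1.7321 * (2 * 3.1416 / 130) := by
      gcongr
    gcongr
    linarith
  linarith

/-- Averaging over the characters of `ZMod L` restricts a bilinear form on the group algebra of
`ZMod L` to the antidiagonal, and preserves estimates on pairs with zero convolution. -/
lemma norm_sum_antidiagonal_le {L : ℕ} [NeZero L] {V : ZMod L → ZMod L → ℂ} {M : ℝ}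
    (hV : ∀ f g : ZMod L → ℂ, (∀ n, ∑ j, f j * g (n - j) = 0) →
      ‖∑ j, ∑ k, f j * g k * V j k‖ ≤ M * (∑ j, ‖f j‖) * (∑ j, ‖g j‖))
    {f g : ZMod L → ℂ} (hfg : ∀ n, ∑ j, f j * g (n - j) = 0) :
    ‖∑ j, f j * g (-j) * V j (-j)‖ ≤ M * (∑ j, ‖f j‖) * (∑ j, ‖g j‖) := by
  have hL : (0 : ℝ) < L := by exact_mod_cast Nat.pos_of_ne_zero (NeZero.ne L)
  have h1 : ∀ s : ZMod L, ‖∑ j, ∑ k, (f j * ZMod.stdAddChar (s * j)) *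
      (g k * ZMod.stdAddChar (s * k)) * V j k‖ ≤ M * (∑ j, ‖f j‖) * (∑ j, ‖g j‖) := by
    intro s
    have := hV (fun j => f j * ZMod.stdAddChar (s * j)) (fun j => g j * ZMod.stdAddChar (s * j))
      fun n => by
        have : ∀ j, f j * ZMod.stdAddChar (s * j) * (g (n - j) * ZMod.stdAddChar (s * (n - j))) =
            ZMod.stdAddChar (s * n) * (f j * g (n - j)) := by
          intro j
          have : s * n = s * j + s * (n - j) := by ring
          rw [this, AddChar.map_add_eq_mul]
          ring
        simp_rw [this, ← Finset.mul_sum, hfg n, mul_zero]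
    simpa only [norm_mul, norm_stdAddChar, mul_one] using this
  have h2 : ∑ s : ZMod L, ∑ j, ∑ k, (f j * ZMod.stdAddChar (s * j)) *
      (g k * ZMod.stdAddChar (s * k)) * V j k = L * ∑ j, f j * g (-j) * V j (-j) := by
    rw [Finset.sum_comm, Finset.mul_sum]
    refine Finset.sum_congr rfl fun j _ => ?_
    rw [Finset.sum_comm]
    have : ∀ k, ∑ s : ZMod L, (f j * ZMod.stdAddChar (s * j)) *
        (g k * ZMod.stdAddChar (s * k)) * V j k =
        f j * g k * V j k * if j + k = 0 then (L : ℂ) else 0 := by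
      intro k
      rw [← sum_stdAddChar_mul, Finset.mul_sum]
      refine Finset.sum_congr rfl fun s _ => ?_
      rw [mul_add, AddChar.map_add_eq_mul]
      ring
    simp_rw [this, add_eq_zero_iff_neg_eq]
    simp only [mul_ite, mul_zero, Finset.sum_ite_eq, Finset.mem_univ, if_true]
    ring
  have h3 : L * ‖∑ j, f j * g (-j) * V j (-j)‖ ≤ L * (M * (∑ j, ‖f j‖) * (∑ j, ‖g j‖)) := by
    rw [← Complex.norm_natCast, ← norm_mul, ← h2, Complex.norm_natCast]
    refine (norm_sum_le _ _).trans ((Finset.sum_le_sum fun s _ => h1 s).trans_eq ?_)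
    simp [ZMod.card]
  exact le_of_mul_le_mul_left h3 hL

open Multiplicative in
/-- A function `W` of two variables in a finite group, small on pairs of elements with zero product
in the group algebra of any cyclic subgroup, is almost constant on the pairs `(t, t⁻¹)`. Writing `S`
for the largest deviation, `norm_sub_le_of_convolution_of_eq_mul` applies to all `t` at once and bounds
`S` in terms of itself. -/
lemma norm_sub_le_of_finite_group {G : Type*} [Group G] [Finite G] {W : G → G → ℂ} {M : ℝ}
    (hM : 0 ≤ M)
    (hW : ∀ (L : ℕ) [NeZero L] (γ : Multiplicative (ZMod L) →* G) (f g : ZMod L → ℂ),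
      (∀ n, ∑ j, f j * g (n - j) = 0) →
      ‖∑ j, ∑ k, f j * g k * W (γ (ofAdd j)) (γ (ofAdd k))‖ ≤
        M * (∑ j, ‖f j‖) * (∑ j, ‖g j‖)) (t : G) :
    ‖W t t⁻¹ - W 1 1‖ ≤ 720 * M := by
  obtain ⟨t₀, ht₀⟩ := Finite.exists_max fun t : G => ‖W t t⁻¹ - W 1 1‖
  set S := ‖W t₀ t₀⁻¹ - W 1 1‖ with hS
  have hN : 0 < Nat.card G := Nat.card_pos
  have : NeZero (130 * Nat.card G) := ⟨by positivity⟩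
  obtain ⟨γ, hγ⟩ : ∃ γ : Multiplicative (ZMod (130 * Nat.card G)) →* G, γ (ofAdd 1) = t₀ := by
    let γ₀ : ZMod (130 * Nat.card G) →+ Additive G :=
      ZMod.lift _ ⟨zmultiplesHom (Additive G) (Additive.ofMul t₀), by
        rw [zmultiplesHom_apply, ← ofMul_zpow, zpow_natCast, mul_comm, pow_mul, pow_card_eq_one',
          one_pow, ofMul_one]⟩
    refine ⟨AddMonoidHom.toMultiplicativeLeft γ₀, ?_⟩
    have : γ₀ ((1 : ℤ) : ZMod _) = Additive.ofMul t₀ := by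
      simp only [γ₀, ZMod.lift_coe, zmultiplesHom_apply, one_zsmul]
    rw [Int.cast_one] at this
    change (γ₀ 1).toMul = t₀
    rw [this, toMul_ofMul]
  have h := norm_sub_le_of_convolution_of_eq_mul
    (H := fun j => W (γ (ofAdd j)) (γ (ofAdd (-j)))) hN rfl hM (S := S) (fun f g hfg => norm_sum_antidiagonal_le
      (V := fun j k => W (γ (ofAdd j)) (γ (ofAdd k))) (hW _ γ) hfg)
    (fun j => by
      have := ht₀ (γ (ofAdd j))
      simpa only [ofAdd_neg, map_inv, neg_zero, ofAdd_zero, map_one] using this)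
  simp only [ofAdd_neg, map_inv, neg_zero, ofAdd_zero, map_one, hγ] at h
  rw [← hS] at h
  refine (ht₀ t).trans ?_
  linarith

/-! ### Product functionals and the optimal constants -/

section ProductFunctionals

variable {A : Type*} [NonUnitalNormedRing A] [NormedSpace ℂ A]

lemma zeroProductSeminorm_nonneg (φ : A →L[ℂ] A →L[ℂ] ℂ) : 0 ≤ zeroProductSeminorm φ := by
  refine Real.sSup_nonneg ?_
  rintro _ ⟨a, b, -, -, -, rfl⟩
  exact norm_nonneg _

lemma DistanceEstimate.alphaConst_le {α : ℝ} (hα : 0 ≤ α) (h : DistanceEstimate A α) :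
    alphaConst A ≤ α :=
  csInf_le ⟨0, fun _ hx => hx.1⟩ ⟨hα, h⟩

variable [IsScalarTower ℂ A A] [SMulCommClass ℂ A A]

lemma norm_apply_le_zeroProductSeminorm (φ : A →L[ℂ] A →L[ℂ] ℂ) {a b : A} (hab : a * b = 0) :
    ‖φ a b‖ ≤ zeroProductSeminorm φ * ‖a‖ * ‖b‖ := by
  rcases eq_or_ne a 0 with rfl | ha
  · simp
  rcases eq_or_ne b 0 with rfl | hb
  · simp
  have ha' : 0 < ‖a‖ := norm_pos_iff.2 ha
  have hb' : 0 < ‖b‖ := norm_pos_iff.2 hb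
  have hbdd : BddAbove {r : ℝ | ∃ a b : A, ‖a‖ = 1 ∧ ‖b‖ = 1 ∧ a * b = 0 ∧ r = ‖φ a b‖} := by
    refine ⟨‖φ‖, ?_⟩
    rintro _ ⟨a, b, ha, hb, -, rfl⟩
    simpa [ha, hb] using φ.le_opNorm₂ a b
  have h : ‖φ ((‖a‖ : ℂ)⁻¹ • a) ((‖b‖ : ℂ)⁻¹ • b)‖ ≤ zeroProductSeminorm φ := by
    refine le_csSup hbdd ⟨_, _, norm_smul_inv_norm ha, norm_smul_inv_norm hb, ?_, rfl⟩
    rw [smul_mul_smul_comm, hab, smul_zero]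
  simp only [map_smul, smul_apply, smul_eq_mul, norm_mul, norm_inv,
    Complex.norm_real, norm_norm] at h
  calc ‖φ a b‖ = ‖b‖⁻¹ * (‖a‖⁻¹ * ‖φ a b‖) * ‖a‖ * ‖b‖ := by field_simp
    _ ≤ _ := by gcongr

/-- The bilinear functional `(a, b) ↦ ξ (a * b)`. -/
noncomputable def productFunctional (ξ : StrongDual ℂ A) : A →L[ℂ] A →L[ℂ] ℂ :=
  (ContinuousLinearMap.compL ℂ A A ℂ ξ).comp (ContinuousLinearMap.mul ℂ A)

lemma productFunctional_mem (ξ : StrongDual ℂ A) : productFunctional ξ ∈ productFunctionals A :=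
  ⟨ξ, fun _ _ => rfl⟩

lemma infDist_productFunctionals_le {φ : A →L[ℂ] A →L[ℂ] ℂ} {ξ : StrongDual ℂ A} {K : ℝ}
    (hK : 0 ≤ K) (h : ∀ a b, ‖φ a b - ξ (a * b)‖ ≤ K * ‖a‖ * ‖b‖) :
    Metric.infDist φ (productFunctionals A) ≤ K := by
  refine (Metric.infDist_le_dist_of_mem (productFunctional_mem ξ)).trans ?_
  exact (dist_eq_norm φ (productFunctional ξ)).trans_le
    (ContinuousLinearMap.opNorm_le_bound₂ _ hK h)

lemma balancedSeminorm_le_infDist (φ : A →L[ℂ] A →L[ℂ] ℂ) :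
    balancedSeminorm φ ≤ 2 * Metric.infDist φ (productFunctionals A) := by
  refine Real.sSup_le ?_ (mul_nonneg zero_le_two Metric.infDist_nonneg)
  rintro _ ⟨a, b, c, ha, hb, hc, rfl⟩
  rw [← div_le_iff₀' zero_lt_two, Metric.le_infDist ⟨_, productFunctional_mem 0⟩]
  rintro ψ ⟨ξ, hξ⟩
  have hd : dist φ ψ = ‖φ - ψ‖ := dist_eq_norm φ ψ
  rw [div_le_iff₀' zero_lt_two, hd]
  have h : φ (a * b) c - φ a (b * c) = (φ - ψ) (a * b) c - (φ - ψ) a (b * c) := by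
    simp only [sub_apply, hξ, mul_assoc]
    ring
  have hab : ‖a * b‖ ≤ 1 := (norm_mul_le a b).trans (by rw [ha, hb, one_mul])
  have hbc : ‖b * c‖ ≤ 1 := (norm_mul_le b c).trans (by rw [hb, hc, one_mul])
  have h1 : ‖(φ - ψ) (a * b) c‖ ≤ ‖φ - ψ‖ * 1 * 1 :=
    ((φ - ψ).le_opNorm₂ _ _).trans (by gcongr; exact hc.le)
  have h2 : ‖(φ - ψ) a (b * c)‖ ≤ ‖φ - ψ‖ * 1 * 1 :=
    ((φ - ψ).le_opNorm₂ _ _).trans (by gcongr; exact ha.le)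
  rw [h]
  refine (norm_sub_le _ _).trans ?_
  linarith

lemma DistanceEstimate.balancedEstimate {α : ℝ} (h : DistanceEstimate A α) :
    BalancedEstimate A (2 * α) := by
  intro φ
  refine (balancedSeminorm_le_infDist φ).trans ?_
  have := h φ
  linarith

lemma DistanceEstimate.betaConst_le {α : ℝ} (hα : 0 ≤ α) (h : DistanceEstimate A α) :
    1 / 2 * betaConst A ≤ alphaConst A := by
  refine le_csInf ⟨α, hα, h⟩ ?_
  rintro α' ⟨hα', h'⟩
  have : betaConst A ≤ 2 * α' :=
    csInf_le ⟨0, fun _ hx => hx.1⟩ ⟨by positivity, h'.balancedEstimate⟩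
  linarith

end ProductFunctionals

/-! ### Averaging over the image of a finite group -/

section GroupImage

open Multiplicative

variable {A : Type*} [NonUnitalNormedRing A] [NormedSpace ℂ A] {G : Type*} [Group G]

lemma norm_sum_smul_le {ρ : G →ₙ* A} {C : ℝ} (hC : ∀ t, ‖ρ t‖ ≤ C) {ι : Type*} [Fintype ι]
    (f : ι → ℂ) (τ : ι → G) : ‖∑ j, f j • ρ (τ j)‖ ≤ (∑ j, ‖f j‖) * C := by
  rw [Finset.sum_mul]
  refine norm_sum_le_of_le _ fun j _ => ?_
  rw [norm_smul]
  gcongr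
  exact hC _

variable [IsScalarTower ℂ A A] [SMulCommClass ℂ A A]

lemma sum_smul_mul_sum_smul_eq_zero (ρ : G →ₙ* A) {L : ℕ} [NeZero L]
    (γ : Multiplicative (ZMod L) →* G) {f g : ZMod L → ℂ}
    (hfg : ∀ n, ∑ j, f j * g (n - j) = 0) :
    (∑ j, f j • ρ (γ (ofAdd j))) * (∑ k, g k • ρ (γ (ofAdd k))) = 0 := by
  rw [Finset.sum_mul_sum]
  have h1 : ∀ j, ∑ k, (f j • ρ (γ (ofAdd j))) * (g k • ρ (γ (ofAdd k))) =
      ∑ n, (f j * g (n - j)) • ρ (γ (ofAdd n)) := by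
    intro j
    rw [← Equiv.sum_comp (Equiv.subRight j)]
    refine Finset.sum_congr rfl fun n _ => ?_
    rw [Equiv.subRight_apply, smul_mul_smul_comm, ← map_mul, ← map_mul, ← ofAdd_add,
      add_sub_cancel]
  simp_rw [h1]
  rw [Finset.sum_comm]
  simp_rw [← Finset.sum_smul, hfg, zero_smul, Finset.sum_const_zero]

lemma norm_translate_sub_le [Finite G] {ρ : G →ₙ* A} {C : ℝ} (hC : ∀ t, ‖ρ t‖ ≤ C)
    (φ : A →L[ℂ] A →L[ℂ] ℂ) (a b : A) (t : G) :
    ‖φ (a * ρ t) (ρ t⁻¹ * b) - φ (a * ρ 1) (ρ 1 * b)‖ ≤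
      720 * (zeroProductSeminorm φ * C ^ 2 * ‖a‖ * ‖b‖) := by
  have hz := zeroProductSeminorm_nonneg φ
  have hC0 : 0 ≤ C := (norm_nonneg _).trans (hC 1)
  refine norm_sub_le_of_finite_group (W := fun s t => φ (a * ρ s) (ρ t * b)) (by positivity) ?_ t
  intro L _ γ f g hfg
  set F := ∑ j, f j • ρ (γ (ofAdd j)) with hF
  set E := ∑ k, g k • ρ (γ (ofAdd k)) with hE
  have hFE : (a * F) * (E * b) = 0 := by
    rw [mul_assoc, ← mul_assoc F, sum_smul_mul_sum_smul_eq_zero ρ γ hfg, zero_mul, mul_zero]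
  have hsum : ∑ j, ∑ k, f j * g k * φ (a * ρ (γ (ofAdd j))) (ρ (γ (ofAdd k)) * b) =
      φ (a * F) (E * b) := by
    rw [hF, hE, Finset.mul_sum, Finset.sum_mul, map_sum φ, sum_apply]
    refine Finset.sum_congr rfl fun j _ => ?_
    rw [map_sum]
    refine Finset.sum_congr rfl fun k _ => ?_
    rw [mul_smul_comm, smul_mul_assoc, map_smul, map_smul, smul_apply,
      smul_eq_mul, smul_eq_mul]
    ring
  rw [hsum]
  have hFn : ‖a * F‖ ≤ ‖a‖ * ((∑ j, ‖f j‖) * C) :=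
    (norm_mul_le _ _).trans (by gcongr; exact norm_sum_smul_le hC _ _)
  have hEn : ‖E * b‖ ≤ ((∑ j, ‖g j‖) * C) * ‖b‖ :=
    (norm_mul_le _ _).trans (by gcongr; exact norm_sum_smul_le hC _ _)
  calc ‖φ (a * F) (E * b)‖ ≤ zeroProductSeminorm φ * ‖a * F‖ * ‖E * b‖ :=
        norm_apply_le_zeroProductSeminorm φ hFE
    _ ≤ zeroProductSeminorm φ * (‖a‖ * ((∑ j, ‖f j‖) * C)) * (((∑ j, ‖g j‖) * C) * ‖b‖) := by
        gcongr
    _ = _ := by ring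

/-- The functional `x ↦ |G|⁻¹ ∑ₜ φ (x ρ(t), ρ(t⁻¹))`, obtained by applying `φ` to the diagonal
`|G|⁻¹ ∑ₜ ρ(t) ⊗ ρ(t⁻¹)` of the span of `ρ(G)`. -/
noncomputable def averageFunctional [Fintype G] (ρ : G →ₙ* A) (φ : A →L[ℂ] A →L[ℂ] ℂ) :
    StrongDual ℂ A :=
  (Fintype.card G : ℂ)⁻¹ •
    ∑ t : G, (φ.flip (ρ t⁻¹)).comp ((ContinuousLinearMap.mul ℂ A).flip (ρ t))

lemma averageFunctional_apply [Fintype G] (ρ : G →ₙ* A) (φ : A →L[ℂ] A →L[ℂ] ℂ) (x : A) :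
    averageFunctional ρ φ x = (Fintype.card G : ℂ)⁻¹ * ∑ t : G, φ (x * ρ t) (ρ t⁻¹) := by
  simp [averageFunctional]

lemma norm_average_le [Fintype G] {v : G → ℂ} {K : ℝ} (hv : ∀ t, ‖v t‖ ≤ K) :
    ‖(Fintype.card G : ℂ)⁻¹ * ∑ t, v t‖ ≤ K := by
  have hcard : (0 : ℝ) < Fintype.card G := by exact_mod_cast Fintype.card_pos
  rw [norm_mul, norm_inv, Complex.norm_natCast, inv_mul_le_iff₀ hcard]
  refine (norm_sum_le_of_le _ fun t _ => hv t).trans_eq ?_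
  simp

lemma norm_averageFunctional_le [Fintype G] {ρ : G →ₙ* A} {C : ℝ} (hC : ∀ t, ‖ρ t‖ ≤ C)
    (φ : A →L[ℂ] A →L[ℂ] ℂ) : ‖averageFunctional ρ φ‖ ≤ ‖φ‖ * C ^ 2 := by
  have hC0 : 0 ≤ C := (norm_nonneg _).trans (hC 1)
  refine ContinuousLinearMap.opNorm_le_bound _ (by positivity) fun x => ?_
  rw [averageFunctional_apply]
  refine norm_average_le fun t => ?_
  calc ‖φ (x * ρ t) (ρ t⁻¹)‖ ≤ ‖φ‖ * ‖x * ρ t‖ * ‖ρ t⁻¹‖ := φ.le_opNorm₂ _ _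
    _ ≤ ‖φ‖ * (‖x‖ * C) * C := by
        gcongr
        · exact (norm_mul_le _ _).trans (by gcongr; exact hC t)
        · exact hC _
    _ = _ := by ring

/-- The diagonal `∑ₜ ρ(t) ⊗ ρ(t⁻¹)` commutes with the span of `ρ(G)`. -/
lemma sum_apply_mul_of_mem_span [Fintype G] (ρ : G →ₙ* A) (φ : A →L[ℂ] A →L[ℂ] ℂ) (a : A)
    {c : A} (hc : c ∈ Submodule.span ℂ (Set.range ρ)) :
    ∑ t : G, φ (a * ρ t) (ρ t⁻¹ * c) = ∑ t : G, φ (a * c * ρ t) (ρ t⁻¹) := by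
  induction hc using Submodule.span_induction with
  | mem x hx =>
    obtain ⟨s, rfl⟩ := hx
    rw [← Equiv.sum_comp (Equiv.mulLeft s)]
    refine Finset.sum_congr rfl fun t _ => ?_
    rw [Equiv.coe_mulLeft, ← map_mul (ρ), mul_inv_rev, inv_mul_cancel_right, map_mul (ρ),
      mul_assoc]
  | zero => simp
  | add x y _ _ hx hy => simp only [mul_add, add_mul, map_add, add_apply,
      Finset.sum_add_distrib, hx, hy]
  | smul r x _ hx => simp only [mul_smul_comm, smul_mul_assoc, map_smul,
      smul_apply, ← Finset.smul_sum, hx]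

lemma norm_sub_averageFunctional_le [Fintype G] {ρ : G →ₙ* A} {C : ℝ} (hC : ∀ t, ‖ρ t‖ ≤ C)
    (φ : A →L[ℂ] A →L[ℂ] ℂ) (a : A) {c : A} (hc : c ∈ Submodule.span ℂ (Set.range ρ)) :
    ‖φ (a * ρ 1) (ρ 1 * c) - averageFunctional ρ φ (a * c)‖ ≤
      720 * C ^ 2 * zeroProductSeminorm φ * ‖a‖ * ‖c‖ := by
  have hcard : (Fintype.card G : ℂ) ≠ 0 := by exact_mod_cast Fintype.card_ne_zero
  rw [averageFunctional_apply, ← sum_apply_mul_of_mem_span ρ φ a hc, norm_sub_rev]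
  have : (Fintype.card G : ℂ)⁻¹ * ∑ t : G, φ (a * ρ t) (ρ t⁻¹ * c) - φ (a * ρ 1) (ρ 1 * c) =
      (Fintype.card G : ℂ)⁻¹ *
        ∑ t : G, (φ (a * ρ t) (ρ t⁻¹ * c) - φ (a * ρ 1) (ρ 1 * c)) := by
    rw [Finset.sum_sub_distrib, Finset.sum_const, Finset.card_univ, nsmul_eq_mul, mul_sub,
      inv_mul_cancel_left₀ hcard]
  rw [this]
  refine (norm_average_le fun t => norm_translate_sub_le hC φ a c t).trans_eq ?_
  ring

end GroupImage

/-- A net of uniformly bounded images of finite groups whose units form a two-sided approximate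
identity, and whose spans contain the corresponding corners, yields a distance estimate: the
required functional is a weak-* cluster point of the functionals `averageFunctional`. -/
theorem distanceEstimate_of_group_images {A : Type*} [NonUnitalNormedRing A] [NormedSpace ℂ A]
    [IsScalarTower ℂ A A] [SMulCommClass ℂ A A] {Λ : Type*} {l : Filter Λ} [l.NeBot]
    {G : Λ → Type*} [∀ i, Group (G i)] [∀ i, Finite (G i)] (ρ : ∀ i, G i →ₙ* A) {C : ℝ}
    (hC : ∀ i t, ‖ρ i t‖ ≤ C)
    (hleft : ∀ a, Tendsto (fun i => ρ i 1 * a) l (𝓝 a))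
    (hright : ∀ a, Tendsto (fun i => a * ρ i 1) l (𝓝 a))
    (hspan : ∀ i a, ρ i 1 * a * ρ i 1 ∈ Submodule.span ℂ (Set.range (ρ i))) :
    DistanceEstimate A (720 * C ^ 2) := by
  intro φ
  have hz := zeroProductSeminorm_nonneg φ
  have (i : Λ) : Fintype (G i) := Fintype.ofFinite _
  obtain ⟨i₀⟩ : Nonempty Λ := l.nonempty_of_neBot
  have hC0 : 0 ≤ C := (norm_nonneg _).trans (hC i₀ 1)
  set R := ‖φ‖ * C ^ 2 with hR
  have hR0 : 0 ≤ R := by positivity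
  let U : Ultrafilter Λ := Ultrafilter.of l
  have hU : (U : Filter Λ) ≤ l := Ultrafilter.of_le l
  obtain ⟨ξ, -, hξ⟩ := (WeakDual.isCompact_closedBall (𝕜 := ℂ) (0 : StrongDual ℂ A) R)
    |>.ultrafilter_le_nhds (U.map fun i => StrongDual.toWeakDual (averageFunctional (ρ i) φ)) (by
      rw [Ultrafilter.coe_map, le_principal_iff, mem_map]
      refine Filter.univ_mem' fun i => ?_
      simpa using norm_averageFunctional_le (hC i) φ)
  have hξ' : ∀ x, Tendsto (fun i => averageFunctional (ρ i) φ x) U (𝓝 (ξ x)) := fun x =>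
    ((WeakDual.eval_continuous x).tendsto ξ).comp hξ
  refine infDist_productFunctionals_le (ξ := WeakDual.toStrongDual ξ) (by positivity) fun a b => ?_
  have hb : Tendsto (fun i => ρ i 1 * b * ρ i 1) l (𝓝 b) := by
    have h1 : Tendsto (fun i => ρ i 1 * (b * ρ i 1 - b)) l (𝓝 0) := by
      refine squeeze_zero_norm (a := fun i => C * ‖b * ρ i 1 - b‖) (fun i => ?_) ?_
      · exact (norm_mul_le _ _).trans (by gcongr; exact hC i 1)
      · simpa using (tendsto_iff_norm_sub_tendsto_zero.1 (hright b)).const_mul C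
    have h2 := h1.add (hleft b)
    rw [zero_add] at h2
    refine h2.congr fun i => ?_
    rw [mul_sub, sub_add_cancel, mul_assoc]
  have h1 : Tendsto (fun i => φ (a * ρ i 1) (ρ i 1 * (ρ i 1 * b * ρ i 1))) U (𝓝 (φ a b)) := by
    have : ∀ i, ρ i 1 * (ρ i 1 * b * ρ i 1) = ρ i 1 * b * ρ i 1 := by
      intro i
      rw [← mul_assoc, ← mul_assoc, ← map_mul, one_mul]
    simp_rw [this]
    have h := (φ.continuous.tendsto a).comp (hright a)
    exact (((isBoundedBilinearMap_apply (𝕜 := ℂ)).continuous.tendsto (φ a, b)).comp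
      ((h.mono_left hU).prodMk_nhds (hb.mono_left hU)))
  have h2 : Tendsto (fun i => averageFunctional (ρ i) φ (a * (ρ i 1 * b * ρ i 1))) U
      (𝓝 (ξ (a * b))) := by
    have h3 : Tendsto (fun i => averageFunctional (ρ i) φ (a * (ρ i 1 * b * ρ i 1 - b))) U
        (𝓝 0) := by
      refine squeeze_zero_norm (a := fun i => R * (‖a‖ * ‖ρ i 1 * b * ρ i 1 - b‖)) (fun i => ?_) ?_
      · refine (ContinuousLinearMap.le_of_opNorm_le _ (norm_averageFunctional_le (hC i) φ) _).trans ?_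
        rw [← hR]
        gcongr
        exact norm_mul_le _ _
      · simpa using (((tendsto_iff_norm_sub_tendsto_zero.1 hb).const_mul ‖a‖).const_mul R).mono_left
          hU
    have h4 := h3.add (hξ' (a * b))
    rw [zero_add] at h4
    refine h4.congr fun i => ?_
    rw [mul_sub, map_sub, sub_add_cancel]
  have h3 : Tendsto (fun i => 720 * C ^ 2 * zeroProductSeminorm φ * ‖a‖ * ‖ρ i 1 * b * ρ i 1‖) U
      (𝓝 (720 * C ^ 2 * zeroProductSeminorm φ * ‖a‖ * ‖b‖)) :=
    (hb.norm.const_mul _).mono_left hU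
  exact le_of_tendsto_of_tendsto' (h1.sub h2).norm h3 fun i =>
    norm_sub_averageFunctional_le (hC i) φ a (hspan i b)

/-! ### Approximate identities of the approximable operators -/

section ApproximableOperators

variable {X : Type*} [NormedAddCommGroup X] [NormedSpace ℂ X]

lemma exists_eq_sum_smulRight {T : X →L[ℂ] X} (hT : (T : X →ₗ[ℂ] X).HasFiniteRange) :
    ∃ (n : ℕ) (ψ : Fin n → StrongDual ℂ X) (x : Fin n → X),
      T = ∑ k, (ψ k).smulRight (x k) := by
  have : FiniteDimensional ℂ (LinearMap.range (T : X →ₗ[ℂ] X)) :=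
    Module.Finite.iff_fg.2 hT.fg_range
  let b := Module.finBasis ℂ (LinearMap.range (T : X →ₗ[ℂ] X))
  let T' : X →L[ℂ] LinearMap.range (T : X →ₗ[ℂ] X) :=
    T.codRestrict _ fun x => LinearMap.mem_range_self (T : X →ₗ[ℂ] X) x
  refine ⟨_, fun k => (LinearMap.toContinuousLinearMap (b.coord k)).comp T', fun k => b k, ?_⟩
  ext y
  have h := congrArg Subtype.val (b.sum_repr (T' y))
  rw [Submodule.coe_sum] at h
  have hy : T y = (T' y : X) := rfl
  rw [hy]
  simpa using h.symm

lemma tendsto_apply_of_mem_closure {E Λ : Type*} [NormedAddCommGroup E] [NormedSpace ℂ E]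
    {l : Filter Λ} {P : Λ → E →L[ℂ] E} {C : ℝ} (hP : ∀ i, ‖P i‖ ≤ C) {s : Set E}
    (hs : ∀ x ∈ s, Tendsto (fun i => P i x) l (𝓝 x)) {x : E} (hx : x ∈ closure s) :
    Tendsto (fun i => P i x) l (𝓝 x) := by
  rw [Metric.tendsto_nhds]
  intro ε hε
  have hC : 0 ≤ max C 0 := le_max_right _ _
  obtain ⟨y, hy, hxy⟩ := Metric.mem_closure_iff.1 hx (ε / (2 * (max C 0 + 1))) (by positivity)
  filter_upwards [Metric.tendsto_nhds.1 (hs y hy) (ε / 2) (by positivity)] with i hi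
  have h1 : dist (P i x) (P i y) ≤ max C 0 * dist x y := by
    rw [dist_eq_norm, dist_eq_norm, ← map_sub]
    exact (P i).le_of_opNorm_le ((hP i).trans (le_max_left _ _)) _
  have h2 : (max C 0 + 1) * dist x y < ε / 2 := by
    rw [lt_div_iff₀ (by positivity)] at hxy
    linarith
  calc dist (P i x) x ≤ dist (P i x) (P i y) + dist (P i y) y + dist y x := dist_triangle4 _ _ _ _
    _ < ε := by rw [dist_comm y x]; linarith

lemma mem_closure_of_mem_approximableOperators {T : X →L[ℂ] X}
    (hT : T ∈ approximableOperators X) :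
    T ∈ closure {T : X →L[ℂ] X | (T : X →ₗ[ℂ] X).HasFiniteRange} := hT

lemma tendsto_mul_left_of_mem_approximableOperators {Λ : Type*} {l : Filter Λ}
    {P : Λ → X →L[ℂ] X} {C : ℝ} (hP : ∀ i, ‖P i‖ ≤ C)
    (h : ∀ x, Tendsto (fun i => P i x) l (𝓝 x)) {T : X →L[ℂ] X}
    (hT : T ∈ approximableOperators X) : Tendsto (fun i => P i * T) l (𝓝 T) := by
  refine tendsto_apply_of_mem_closure (P := fun i => ContinuousLinearMap.mul ℂ _ (P i))
    (fun i => (ContinuousLinearMap.opNorm_mul_apply_le _ _ _).trans (hP i)) ?_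
    (mem_closure_of_mem_approximableOperators hT)
  intro S hS
  obtain ⟨n, ψ, x, rfl⟩ := exists_eq_sum_smulRight hS
  simp only [ContinuousLinearMap.mul_apply', Finset.mul_sum]
  refine tendsto_finsetSum _ fun k _ => ?_
  refine (((ContinuousLinearMap.smulRightL ℂ X X (ψ k)).continuous.tendsto (x k)).comp
    (h (x k))).congr fun i => ?_
  ext y
  simp

lemma tendsto_mul_right_of_mem_approximableOperators {Λ : Type*} {l : Filter Λ}
    {P : Λ → X →L[ℂ] X} {C : ℝ} (hP : ∀ i, ‖P i‖ ≤ C)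
    (h : ∀ ψ : StrongDual ℂ X, Tendsto (fun i => ψ.comp (P i)) l (𝓝 ψ)) {T : X →L[ℂ] X}
    (hT : T ∈ approximableOperators X) : Tendsto (fun i => T * P i) l (𝓝 T) := by
  refine tendsto_apply_of_mem_closure (P := fun i => (ContinuousLinearMap.mul ℂ _).flip (P i))
    (fun i => ContinuousLinearMap.opNorm_le_bound _ ((norm_nonneg _).trans (hP i)) fun S => ?_) ?_
    (mem_closure_of_mem_approximableOperators hT)
  · rw [ContinuousLinearMap.flip_apply, ContinuousLinearMap.mul_apply', mul_comm C]
    exact (norm_mul_le _ _).trans (by gcongr; exact hP i)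
  intro S hS
  obtain ⟨n, ψ, x, rfl⟩ := exists_eq_sum_smulRight hS
  simp only [ContinuousLinearMap.flip_apply, ContinuousLinearMap.mul_apply', Finset.sum_mul]
  refine tendsto_finsetSum _ fun k _ => ?_
  refine ((((ContinuousLinearMap.smulRightL ℂ X X).flip (x k)).continuous.tendsto (ψ k)).comp
    (h (ψ k))).congr fun i => ?_
  ext y
  simp

end ApproximableOperators

/-! ### The homomorphism of a finite biorthogonal system -/

section Theta

variable {X : Type*} [NormedAddCommGroup X] [NormedSpace ℂ X] {n : ℕ} (B : BiorthogonalSystem X n)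

lemma BiorthogonalSystem.theta_apply (a : Matrix (Fin n) (Fin n) ℂ) (y : X) :
    B.theta a y = ∑ j, ∑ k, (a j k * B.functional k y) • B.vec j := by
  simp [theta, smul_smul, sum_apply]

lemma BiorthogonalSystem.functional_theta (a : Matrix (Fin n) (Fin n) ℂ) (i : Fin n) (y : X) :
    B.functional i (B.theta a y) = ∑ k, a i k * B.functional k y := by
  rw [theta_apply]
  simp only [map_sum, map_smul, B.biorthogonal, smul_eq_mul, mul_ite, mul_one, mul_zero]
  rw [Finset.sum_comm]
  simp

lemma BiorthogonalSystem.theta_mul (a b : Matrix (Fin n) (Fin n) ℂ) :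
    B.theta (a * b) = B.theta a * B.theta b := by
  ext y
  rw [mul_apply_eq_comp, theta_apply, theta_apply B a]
  refine Finset.sum_congr rfl fun j _ => ?_
  simp only [functional_theta, Matrix.mul_apply, ← Finset.sum_smul, Finset.mul_sum, Finset.sum_mul]
  rw [Finset.sum_comm]
  simp only [mul_assoc]

lemma BiorthogonalSystem.hasFiniteRange_theta (a : Matrix (Fin n) (Fin n) ℂ) :
    (B.theta a : X →ₗ[ℂ] X).HasFiniteRange := by
  have h : LinearMap.range (B.theta a : X →ₗ[ℂ] X) ≤ Submodule.span ℂ (Set.range B.vec) := by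
    rintro _ ⟨y, rfl⟩
    rw [ContinuousLinearMap.coe_coe, theta_apply]
    exact Submodule.sum_mem _ fun j _ => Submodule.sum_mem _ fun k _ =>
      Submodule.smul_mem _ _ (Submodule.subset_span ⟨j, rfl⟩)
  have : FiniteDimensional ℂ (Submodule.span ℂ (Set.range B.vec)) :=
    FiniteDimensional.span_of_finite ℂ (Set.finite_range _)
  rw [LinearMap.hasFiniteRange_iff_range]
  exact Module.Finite.iff_fg.1 (Submodule.finiteDimensional_of_le h)

lemma BiorthogonalSystem.theta_one_mul_mul (T : X →L[ℂ] X) :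
    B.theta 1 * T * B.theta 1 = B.theta (Matrix.of fun j k => B.functional j (T (B.vec k))) := by
  have h1 : ∀ y, B.theta 1 y = ∑ k, B.functional k y • B.vec k := by
    intro y
    simp [theta_apply, Matrix.one_apply]
  ext y
  rw [mul_apply_eq_comp, mul_apply_eq_comp, h1 y, h1, theta_apply]
  simp only [map_sum, map_smul, smul_eq_mul, Finset.sum_smul, Matrix.of_apply, mul_comm]

/-- The map `θ`, as a linear map into the algebra of approximable operators. -/
noncomputable def BiorthogonalSystem.thetaLinear :
    Matrix (Fin n) (Fin n) ℂ →ₗ[ℂ] approximableOperators X where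
  toFun a := ⟨B.theta a, subset_closure (B.hasFiniteRange_theta a)⟩
  map_add' a b := by
    ext y
    simp [theta, add_smul, Finset.sum_add_distrib]
  map_smul' c a := by
    ext y
    simp [theta, Finset.smul_sum, smul_smul, mul_assoc, sum_apply]

@[simp]
lemma BiorthogonalSystem.coe_thetaLinear (a : Matrix (Fin n) (Fin n) ℂ) :
    (B.thetaLinear a : X →L[ℂ] X) = B.theta a := rfl

/-- The restriction of `θ` to a group of invertible matrices. -/
noncomputable def BiorthogonalSystem.groupHom (G : Subgroup (GL (Fin n) ℂ)) :
    G →ₙ* approximableOperators X where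
  toFun t := B.thetaLinear (t : GL (Fin n) ℂ)
  map_mul' s t := Subtype.ext <| by
    simp [theta_mul]

lemma BiorthogonalSystem.coe_groupHom (G : Subgroup (GL (Fin n) ℂ)) (t : G) :
    (B.groupHom G t : X →L[ℂ] X) = B.theta (t : GL (Fin n) ℂ) := rfl

lemma BiorthogonalSystem.coe_groupHom_one (G : Subgroup (GL (Fin n) ℂ)) :
    (B.groupHom G 1 : X →L[ℂ] X) = B.theta 1 := by
  simp [coe_groupHom]

lemma BiorthogonalSystem.mul_mul_mem_span_range_groupHom {G : Subgroup (GL (Fin n) ℂ)}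
    (hG : Submodule.span ℂ {a : Matrix (Fin n) (Fin n) ℂ | ∃ t ∈ G, a = t} = ⊤)
    (a : approximableOperators X) :
    B.groupHom G 1 * a * B.groupHom G 1 ∈ Submodule.span ℂ (Set.range (B.groupHom G)) := by
  have h : B.groupHom G 1 * a * B.groupHom G 1 =
      B.thetaLinear (Matrix.of fun j k => B.functional j ((a : X →L[ℂ] X) (B.vec k))) := by
    refine Subtype.ext ?_
    rw [NonUnitalSubalgebra.coe_mul, NonUnitalSubalgebra.coe_mul, coe_groupHom_one,
      theta_one_mul_mul, coe_thetaLinear]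
  have himage : Set.range (B.groupHom G) =
      B.thetaLinear '' {a : Matrix (Fin n) (Fin n) ℂ | ∃ t ∈ G, a = t} := by
    ext x
    constructor
    · rintro ⟨t, rfl⟩
      exact ⟨_, ⟨t, t.2, rfl⟩, rfl⟩
    · rintro ⟨_, ⟨t, ht, rfl⟩, rfl⟩
      exact ⟨⟨t, ht⟩, rfl⟩
  rw [h, himage, Submodule.span_image, hG]
  exact Submodule.mem_map_of_mem Submodule.mem_top

end Theta

/-! ### Property `(𝔸)` -/

lemma PropertyASystem.distanceEstimate {X : Type u} [NormedAddCommGroup X] [NormedSpace ℂ X]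
    {Λ : Type w} [Preorder Λ] [IsDirectedOrder Λ] [Nonempty Λ] (S : PropertyASystem X Λ) :
    DistanceEstimate (approximableOperators X) (720 * S.bound ^ 2) := by
  have hC : ∀ i (t : S.grp i), ‖(S.sys i).groupHom (S.grp i) t‖ ≤ S.bound := fun i t =>
    le_csSup S.bounded ⟨i, t, t.2, rfl⟩
  have (i : Λ) : Finite (S.grp i) := S.finite_grp i
  have hC1 : ∀ i, ‖(S.sys i).theta 1‖ ≤ S.bound := fun i => by
    have := hC i 1
    rwa [← (S.sys i).coe_groupHom_one (S.grp i)]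
  refine distanceEstimate_of_group_images (l := atTop)
    (fun i => (S.sys i).groupHom (S.grp i)) hC (fun a => ?_) (fun a => ?_)
    fun i a => (S.sys i).mul_mul_mem_span_range_groupHom (S.span_grp i) a
  · rw [tendsto_subtype_rng]
    simp only [NonUnitalSubalgebra.coe_mul, BiorthogonalSystem.coe_groupHom_one]
    exact tendsto_mul_left_of_mem_approximableOperators hC1
      (fun x => (S.tendsto_id {x} isCompact_singleton).tendsto_at rfl) a.2
  · rw [tendsto_subtype_rng]
    simp only [NonUnitalSubalgebra.coe_mul, BiorthogonalSystem.coe_groupHom_one]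
    exact tendsto_mul_right_of_mem_approximableOperators hC1
      (fun ψ => (S.tendsto_adjoint {ψ} isCompact_singleton).tendsto_at rfl) a.2

lemma distanceConstant_le :
    720 ≤ 60 * √27 * ((1 + Real.sin (Real.pi / 10)) / (1 - 2 * Real.sin (Real.pi / 10))) := by
  have hπ := Real.pi_gt_d2
  have hπ' := Real.pi_lt_d2
  have h27 : 5 ≤ √27 := Real.le_sqrt_of_sq_le (by norm_num)
  have hs : 0.3 ≤ Real.sin (Real.pi / 10) := by
    have h := Real.sin_gt_sub_cube (x := Real.pi / 10) (by positivity)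
    have h3 : (Real.pi / 10) ^ 3 ≤ 0.315 ^ 3 := by
      gcongr
      linarith
    norm_num at h3 ⊢
    linarith
  have hs' : Real.sin (Real.pi / 10) < 1 / 2 := by
    have := Real.sin_lt (x := Real.pi / 10) (by positivity)
    linarith
  have hq : 3 ≤ (1 + Real.sin (Real.pi / 10)) / (1 - 2 * Real.sin (Real.pi / 10)) := by
    rw [le_div_iff₀ (by linarith)]
    norm_num at hs
    linarith
  calc (720 : ℝ) ≤ 60 * 5 * 3 := by norm_num
    _ ≤ _ := by gcongr

theorem theorem4p1 (X : Type u) [NormedAddCommGroup X] [NormedSpace ℂ X] [CompleteSpace X]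
    (hX : HasPropertyA.{u, w} X) :
    StronglyZeroProductDetermined (approximableOperators X) ∧
    StrongPropertyB (approximableOperators X) ∧
    1 / 2 * betaConst (approximableOperators X) ≤ alphaConst (approximableOperators X) ∧
    ∀ (Λ : Type w) [Preorder Λ] [IsDirectedOrder Λ] [Nonempty Λ] (S : PropertyASystem X Λ),
      alphaConst (approximableOperators X) ≤
        60 * Real.sqrt 27 *
          ((1 + Real.sin (Real.pi / 10)) / (1 - 2 * Real.sin (Real.pi / 10))) *
          S.bound ^ 2 := by
  obtain ⟨Λ₀, _, _, _, ⟨S₀⟩⟩ := hX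
  have h₀ := S₀.distanceEstimate
  refine ⟨⟨_, h₀⟩, ⟨_, h₀.balancedEstimate⟩, h₀.betaConst_le (by positivity), ?_⟩
  intro Λ _ _ _ S
  refine (S.distanceEstimate.alphaConst_le (by positivity)).trans ?_
  gcongr
  exact distanceConstant_le
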